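/- Let $a,c\in\mathbb R$ with $c<0<a$ and $c<-a-c<a$, let $y\in[c,-a-c]$, and put $q=\sqrt{\frac{2c+a}{c-a}}\in(0,1)$, $\omega=\sqrt{\frac{a-c}{6}}$. Let $F(\gamma,q)=\int_0^\gamma\frac{d\alpha}{\sqrt{1-q^2\sin^2\alpha}}$, let $\mathrm{sn},\mathrm{cn},\mathrm{dn}$ be the Jacobi elliptic functions of modulus $q$ (so $\mathrm{sn}(u,q)=\sin\gamma$ and $\mathrm{cn}(u,q)=\cos\gamma$ for $u=F(\gamma,q)$, and $\mathrm{dn}=\sqrt{1-q^2\mathrm{sn}^2}$), let $\mathcal E(u,q)=\int_0^u\mathrm{dn}^2(t,q)\,dt$, and put $i_y=F\big(\arcsin\sqrt{\tfrac{c-y}{2c+a}},q\big)$. Let $$x_0(t)=c-(a+2c)\,\mathrm{sn}^2(\omega t+i_y,q),\qquad t\ge 0 .$$ Let $u_1=\mathrm{sn}\,\mathrm{cn}\,\mathrm{dn}$ and $$u_2(t)=(-1+q^2)+(-2q^6+3q^4-5q^2+2)\,\mathrm{cn}^2(t,q)+2q^2(q^4-q^2+1)\,\mathrm{cn}^4(t,q)+\big[(-q^4+3q^2-2)\,t+2(q^4-q^2+1)\,\mathcal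 E(t,q)\big]u_1(t),$$ and put $w_1(t)=k_1u_1(\omega t+i_y)$, $w_2(t)=k_2u_2(\omega t+i_y)$, where the constants $k_1,k_2$ satisfy $-k_1k_2\,\omega(1-q^2)^2=1$ (that is, the Wronskian $w_1\dot w_2-\dot w_1w_2$ equals $1$). Let $\mathcal K(t,s)=w_2(t)w_1(s)-w_1(t)w_2(s)$. Let $B$ be a standard one-dimensional Brownian motion on a probability space $(\Omega,\mathcal F,\mathbb P)$, and let $\{\mathcal F^B_t\}_{t\ge0}$ be its filtration, augmented by the $\mathbb P$-null events. Let $x_1$ be a global strong solution, adapted to $\{\mathcal F^B_t\}$, of $\ddot x_1=2x_0x_1+\dot B$, $x_1(0)=\dot x_1(0)=0$, that is, of the system $dx_1=\xi_1\,dt$, $d\xi_1=2x_0x_1\,dt+dB$, $x_1(0)=\xi_1(0)=0$; and, inductively for $n\ge2$, let $x_n$ be a global strong solution, adapted to $\{\mathcal F^B_t\}$, of the random linear equation $$\ddot x_n(t)=2x_0(t)x_n(t)+\sum_{j=1}^{n-1}x_j(t)x_{n-j}(t),\qquad x_n(0)=\dot x_n(0)=0 .\tag{$*$}$$ **Theorem.**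 Let $n\ge2$. Processes $x_1,\dots,x_{n-1}$ as above exist, and for every such choice of them equation $(*)$ has a global strong solution $x_n$ on $[0,\infty)$ adapted to $\{\mathcal F^B_t\}_{t\ge0}$, unique up to indistinguishability. Almost surely, for all $t\ge0$, $$x_n(t)=w_2(t)\int_0^tw_1(s)\Big(\sum_{j=1}^{n-1}x_j(s)x_{n-j}(s)\Big)ds-w_1(t)\int_0^tw_2(s)\Big(\sum_{j=1}^{n-1}x_j(s)x_{n-j}(s)\Big)ds,$$ or equivalently $$x_n(t)=\int_0^t\mathcal K(t,s)\Big(\sum_{j=1}^{n-1}x_j(s)x_{n-j}(s)\Big)ds .$$ -/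

import Mathlib

open MeasureTheory ProbabilityTheory
open scoped NNReal

namespace LameExpansion

noncomputable section

/-! ### Elliptic integral and Jacobi elliptic functions of modulus `q` (used for `0 < q < 1`) -/

/-- Incomplete elliptic integral of the first kind `F(φ, q)`. -/
def ellipticF (φ q : ℝ) : ℝ :=
  ∫ α in (0 : ℝ)..φ, 1 / Real.sqrt (1 - q ^ 2 * Real.sin α ^ 2)

/-- Jacobi amplitude: the inverse of `φ ↦ F(φ, q)`, a bijection of `ℝ` when `0 ≤ q < 1`. -/
def jacobiAm (u q : ℝ) : ℝ := Function.invFun (fun φ : ℝ => ellipticF φ q) u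

/-- `sn(u, q) = sin γ`, where `u = F(γ, q)`. -/
def jacobiSn (u q : ℝ) : ℝ := Real.sin (jacobiAm u q)

/-- `cn(u, q) = cos γ`, where `u = F(γ, q)`. -/
def jacobiCn (u q : ℝ) : ℝ := Real.cos (jacobiAm u q)

/-- `dn(u, q) = √(1 - q² sn²(u, q))`. -/
def jacobiDn (u q : ℝ) : ℝ := Real.sqrt (1 - q ^ 2 * jacobiSn u q ^ 2)

/-- Jacobi's Epsilon function `∫₀ᵘ dn²(t, q) dt`. -/
def jacobiEpsilon (u q : ℝ) : ℝ := ∫ t in (0 : ℝ)..u, jacobiDn t q ^ 2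

/-! ### The unperturbed solution `x₀`

The cubic `(x - a)(x + a + c)(x - c) / 3` has the roots `c < -a-c < a`, and `y ∈ [c, -a-c]` is the
initial position. -/

/-- The modulus `q = √((2c + a) / (c - a))`. -/
def modulus (a c : ℝ) : ℝ := Real.sqrt ((2 * c + a) / (c - a))

/-- The frequency `√((a - c) / 6)`. -/
def freq (a c : ℝ) : ℝ := Real.sqrt ((a - c) / 6)

/-- The phase `i_y = F(arcsin √((c - y) / (2c + a)), q)`. -/
def phase (a c y : ℝ) : ℝ :=
  ellipticF (Real.arcsin (Real.sqrt ((c - y) / (2 * c + a)))) (modulus a c)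

/-- `x₀(t) = c - (a + 2c) sn²(√((a - c)/6) t + i_y, q)`. -/
def xZero (a c y t : ℝ) : ℝ :=
  c - (a + 2 * c) * jacobiSn (freq a c * t + phase a c y) (modulus a c) ^ 2

/-! ### The two solutions of the Lamé equation and the kernel -/

/-- `u₁ = sn cn dn`. -/
def lameU1 (q t : ℝ) : ℝ := jacobiSn t q * jacobiCn t q * jacobiDn t q

/-- The second solution
`u₂ = α₀ + α₁ cn² + α₂ cn⁴ + (β₀ t + β₁ 𝓔) u₁`. -/
def lameU2 (q t : ℝ) : ℝ :=
  ((-1 + q ^ 2)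
    + (-2 * q ^ 6 + 3 * q ^ 4 - 5 * q ^ 2 + 2) * jacobiCn t q ^ 2
    + (2 * q ^ 2 * (q ^ 4 - q ^ 2 + 1)) * jacobiCn t q ^ 4)
  + ((-q ^ 4 + 3 * q ^ 2 - 2) * t
    + (2 * (q ^ 4 - q ^ 2 + 1)) * jacobiEpsilon t q) * lameU1 q t

/-- `w₁(t) = k₁ u₁(√((a - c)/6) t + i_y)`, with a normalizing constant `k₁`. -/
def wOne (a c y k₁ t : ℝ) : ℝ := k₁ * lameU1 (modulus a c) (freq a c * t + phase a c y)

/-- `w₂(t) = k₂ u₂(√((a - c)/6) t + i_y)`, with a normalizing constant `k₂`. -/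
def wTwo (a c y k₂ t : ℝ) : ℝ := k₂ * lameU2 (modulus a c) (freq a c * t + phase a c y)

/-- For `k₁ = k₂ = 1` the Wronskian of `(w₁, w₂)` is the constant `-√((a - c)/6) (1 - q²)²`, so this
condition on the normalizing constants says that the Wronskian of `(w₁, w₂)` is `1`. -/
def WronskianNormalized (a c k₁ k₂ : ℝ) : Prop :=
  k₁ * k₂ * (-(freq a c * (1 - modulus a c ^ 2) ^ 2)) = 1

/-- `K(t, s) = w₂(t) w₁(s) - w₁(t) w₂(s)`. -/
def kernelK (a c y k₁ k₂ t s : ℝ) : ℝ :=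
  wTwo a c y k₂ t * wOne a c y k₁ s - wOne a c y k₁ t * wTwo a c y k₂ s

/-! ### The stochastic equations -/

variable {Ω : Type*} {mΩ : MeasurableSpace Ω}

/-- The Brownian filtration: `𝓕ᴮ_t` is generated by `B_s`, `s ≤ t`, and the `P`-null events. -/
def brownianFiltration (B : ℝ≥0 → Ω → ℝ) (hB : ∀ t, Measurable (B t)) (P : Measure Ω) :
    Filtration ℝ≥0 mΩ where
  seq t := (⨆ s ≤ t, MeasurableSpace.comap (B s) inferInstance) ⊔
    MeasurableSpace.generateFrom {N | MeasurableSet N ∧ P N = 0}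
  mono' _ _ hij := sup_le_sup_right (biSup_mono fun _ h => h.trans hij) _
  le' _ := sup_le (iSup₂_le fun s _ => (hB s).comap_le)
    (MeasurableSpace.generateFrom_le fun _ h => h.1)

/-- The path `t ↦ X_t(ω)` as a function of real time (only its values at `t ≥ 0` matter). -/
def path (X : ℝ≥0 → Ω → ℝ) (ω : Ω) (t : ℝ) : ℝ := X t.toNNReal ω

/-- `z` is a global strong solution, adapted to the filtration `𝓕`, of
`z̈ = 2 x₀ z + Ḃ`, `z(0) = ż(0) = 0`, that is, of the system
`dz = ξ dt`, `dξ = 2 x₀ z dt + dB`, `z(0) = ξ(0) = 0`. -/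
def IsStrongSolutionOne (𝓕 : Filtration ℝ≥0 mΩ) (P : Measure Ω) (x₀ : ℝ → ℝ)
    (B z : ℝ≥0 → Ω → ℝ) : Prop :=
  Adapted 𝓕 z ∧ ∃ ξ : ℝ≥0 → Ω → ℝ, Adapted 𝓕 ξ ∧
    ∀ᵐ ω ∂P, z 0 ω = 0 ∧ ξ 0 ω = 0 ∧
      (∀ t : ℝ≥0, HasDerivWithinAt (path z ω) (ξ t ω) (Set.Ici 0) (t : ℝ)) ∧
      (∀ t : ℝ≥0, ξ t ω =
        (∫ s in (0 : ℝ)..t, 2 * x₀ s * path z ω s) + (B t ω - B 0 ω))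

/-- `∑_{j=1}^{n-1} x_j(s) x_{n-j}(s)` along the path `ω`. -/
def forcing (n : ℕ) (x : ℕ → ℝ≥0 → Ω → ℝ) (ω : Ω) (s : ℝ) : ℝ :=
  ∑ j ∈ Finset.Ico 1 n, path (x j) ω s * path (x (n - j)) ω s

/-- `z` is a global strong solution, adapted to the filtration `𝓕`, of
`z̈ = 2 x₀ z + ∑_{j=1}^{n-1} x_j x_{n-j}`, `z(0) = ż(0) = 0`, that is, of the system
`ż = ξ`, `ξ̇ = 2 x₀ z + ∑_{j=1}^{n-1} x_j x_{n-j}`, `z(0) = ξ(0) = 0`. -/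
def IsStrongSolution (𝓕 : Filtration ℝ≥0 mΩ) (P : Measure Ω) (x₀ : ℝ → ℝ)
    (n : ℕ) (x : ℕ → ℝ≥0 → Ω → ℝ) (z : ℝ≥0 → Ω → ℝ) : Prop :=
  Adapted 𝓕 z ∧ ∃ ξ : ℝ≥0 → Ω → ℝ, Adapted 𝓕 ξ ∧
    ∀ᵐ ω ∂P, z 0 ω = 0 ∧ ξ 0 ω = 0 ∧
      (∀ t : ℝ≥0, HasDerivWithinAt (path z ω) (ξ t ω) (Set.Ici 0) (t : ℝ)) ∧
      (∀ t : ℝ≥0, HasDerivWithinAt (path ξ ω)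
        (2 * x₀ t * z t ω + forcing n x ω t) (Set.Ici 0) (t : ℝ))

/-- `x 1, …, x (n - 1)` are the coefficient processes below level `n` (for `n ≥ 2`): `x 1` solves
`ẍ₁ = 2 x₀ x₁ + Ḃ`, and each `x m` with `2 ≤ m < n` solves
`ẍ_m = 2 x₀ x_m + ∑_{j=1}^{m-1} x_j x_{m-j}`, all with zero initial data. -/
def IsCoefficientFamilyBelow (𝓕 : Filtration ℝ≥0 mΩ) (P : Measure Ω) (x₀ : ℝ → ℝ)
    (B : ℝ≥0 → Ω → ℝ) (n : ℕ) (x : ℕ → ℝ≥0 → Ω → ℝ) : Prop :=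
  IsStrongSolutionOne 𝓕 P x₀ B (x 1) ∧
    ∀ m, 2 ≤ m → m < n → IsStrongSolution 𝓕 P x₀ m x (x m)

end

end LameExpansion

namespace LameExpansion

/-! ### The Jacobi elliptic functions -/

section Jacobi

variable {q : ℝ}

/-! Path by path, the equation of order `n` is a linear ODE `z'' = 2 x₀ z + f` with continuous `f`;
probability enters only through null sets and adaptedness. With the time change `u = ω t + i_y` the
homogeneous equation becomes Lamé's equation `u'' = (12 q² sn² - 4 (1 + q²)) u`
(`sq_freq_mul_potential`). That `u₁`, `u₂` solve it with Wronskian `-(1 - q²)²` is algebra modulo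
`cn² = 1 - sn²` and `dn² = 1 - q² sn²`. For the normalized pair, `mul_sub_mul_eq_integral` gives `wᵢ
z' - wᵢ' z = ∫ wᵢ f`. Eliminating `z'` forces the formula, hence uniqueness; conversely the formula
defines a solution, adapted by `adapted_integral`. At order one, integration by parts removes `dB`,
so no stochastic integral is needed. Recursion on the order yields the whole family. -/

lemma one_sub_sq_mul_sin_sq_pos (hq : q ^ 2 < 1) (α : ℝ) :
    0 < 1 - q ^ 2 * Real.sin α ^ 2 := by
  nlinarith [Real.sin_sq_le_one α, sq_nonneg q, sq_nonneg (Real.sin α)]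

lemma continuous_ellipticF_integrand (hq : q ^ 2 < 1) :
    Continuous fun α : ℝ => 1 / Real.sqrt (1 - q ^ 2 * Real.sin α ^ 2) :=
  continuous_const.div (by fun_prop)
    fun α => (Real.sqrt_pos.2 (one_sub_sq_mul_sin_sq_pos hq α)).ne'

lemma one_le_ellipticF_integrand (hq : q ^ 2 < 1) (α : ℝ) :
    1 ≤ 1 / Real.sqrt (1 - q ^ 2 * Real.sin α ^ 2) := by
  rw [one_le_div (Real.sqrt_pos.2 (one_sub_sq_mul_sin_sq_pos hq α))]
  refine Real.sqrt_le_one.2 ?_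
  nlinarith [mul_nonneg (sq_nonneg q) (sq_nonneg (Real.sin α))]

lemma hasDerivAt_ellipticF (hq : q ^ 2 < 1) (φ : ℝ) :
    HasDerivAt (fun φ => ellipticF φ q) (1 / Real.sqrt (1 - q ^ 2 * Real.sin φ ^ 2)) φ :=
  (continuous_ellipticF_integrand hq).integral_hasStrictDerivAt 0 φ |>.hasDerivAt

/-- The integrand is at least `1`. This one bound yields both injectivity and surjectivity of `F(·,
q)`, so that `jacobiAm` is a genuine inverse. -/
lemma monotone_ellipticF_sub_id (hq : q ^ 2 < 1) : Monotone fun φ => ellipticF φ q - φ := by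
  have h : ∀ φ, HasDerivAt (fun φ => ellipticF φ q - φ)
      (1 / Real.sqrt (1 - q ^ 2 * Real.sin φ ^ 2) - 1) φ := fun φ =>
    (hasDerivAt_ellipticF hq φ).sub (hasDerivAt_id φ)
  refine monotone_of_deriv_nonneg (fun φ => (h φ).differentiableAt) fun φ => ?_
  rw [(h φ).deriv]
  linarith [one_le_ellipticF_integrand hq φ]

lemma strictMono_ellipticF (hq : q ^ 2 < 1) : StrictMono fun φ => ellipticF φ q := by
  intro φ ψ h
  have := monotone_ellipticF_sub_id hq h.le
  simp only at this ⊢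
  linarith

lemma surjective_ellipticF (hq : q ^ 2 < 1) : Function.Surjective fun φ => ellipticF φ q := by
  have h0 : ellipticF 0 q = 0 := by simp [ellipticF]
  refine Continuous.surjective
    (continuous_iff_continuousAt.2 fun φ => (hasDerivAt_ellipticF hq φ).continuousAt) ?_ ?_
  · refine Filter.tendsto_atTop_mono' _ ?_ Filter.tendsto_id
    filter_upwards [Filter.eventually_ge_atTop 0] with φ hφ
    have := monotone_ellipticF_sub_id hq hφ
    simp only [h0, id] at this ⊢
    linarith
  · refine Filter.tendsto_atBot_mono' _ ?_ Filter.tendsto_id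
    filter_upwards [Filter.eventually_le_atBot 0] with φ hφ
    have := monotone_ellipticF_sub_id hq hφ
    simp only [h0, id] at this ⊢
    linarith

lemma ellipticF_jacobiAm (hq : q ^ 2 < 1) (u : ℝ) : ellipticF (jacobiAm u q) q = u :=
  Function.rightInverse_invFun (surjective_ellipticF hq) u

/-- A monotone surjection of `ℝ` is continuous; the derivative of the inverse needs this as input.
-/
lemma continuous_jacobiAm (hq : q ^ 2 < 1) : Continuous fun u => jacobiAm u q := by
  have hmono : StrictMono fun u => jacobiAm u q := fun u v h => by
    rw [← (strictMono_ellipticF hq).lt_iff_lt]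
    simpa [ellipticF_jacobiAm hq] using h
  refine hmono.monotone.continuous_of_surjective fun φ => ⟨ellipticF φ q, ?_⟩
  exact Function.leftInverse_invFun (strictMono_ellipticF hq).injective φ

lemma hasDerivAt_jacobiAm (hq : q ^ 2 < 1) (u : ℝ) :
    HasDerivAt (fun u => jacobiAm u q) (jacobiDn u q) u := by
  have hpos := Real.sqrt_pos.2 (one_sub_sq_mul_sin_sq_pos hq (jacobiAm u q))
  have h := HasDerivAt.of_local_left_inverse (f := fun φ => ellipticF φ q)
    (continuous_jacobiAm hq).continuousAt
    (hasDerivAt_ellipticF hq (jacobiAm u q)) (one_div_pos.2 hpos).ne'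
    (Filter.Eventually.of_forall fun v => ellipticF_jacobiAm hq v)
  simpa [jacobiDn, jacobiSn] using h

lemma hasDerivAt_jacobiSn (hq : q ^ 2 < 1) (u : ℝ) :
    HasDerivAt (fun u => jacobiSn u q) (jacobiCn u q * jacobiDn u q) u :=
  (hasDerivAt_jacobiAm hq u).sin

lemma hasDerivAt_jacobiCn (hq : q ^ 2 < 1) (u : ℝ) :
    HasDerivAt (fun u => jacobiCn u q) (-jacobiSn u q * jacobiDn u q) u :=
  (hasDerivAt_jacobiAm hq u).cos

lemma jacobiCn_sq (u q : ℝ) : jacobiCn u q ^ 2 = 1 - jacobiSn u q ^ 2 :=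
  Real.cos_sq' _

lemma jacobiDn_sq (hq : q ^ 2 < 1) (u : ℝ) : jacobiDn u q ^ 2 = 1 - q ^ 2 * jacobiSn u q ^ 2 :=
  Real.sq_sqrt (one_sub_sq_mul_sin_sq_pos hq _).le

lemma hasDerivAt_jacobiDn (hq : q ^ 2 < 1) (u : ℝ) :
    HasDerivAt (fun u => jacobiDn u q) (-q ^ 2 * jacobiSn u q * jacobiCn u q) u := by
  have hpos : 0 < 1 - q ^ 2 * jacobiSn u q ^ 2 := one_sub_sq_mul_sin_sq_pos hq _
  have hd : jacobiDn u q ≠ 0 := (Real.sqrt_pos.2 hpos).ne'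
  have h := ((((hasDerivAt_jacobiSn hq u).pow 2).const_mul (q ^ 2)).const_sub 1).sqrt hpos.ne'
  refine h.congr_deriv ?_
  change _ / (2 * jacobiDn u q) = _
  field_simp
  simp
  ring

lemma hasDerivAt_jacobiEpsilon (hq : q ^ 2 < 1) (u : ℝ) :
    HasDerivAt (fun u => jacobiEpsilon u q) (jacobiDn u q ^ 2) u := by
  have hc : Continuous fun u => jacobiDn u q ^ 2 :=
    (continuous_iff_continuousAt.2 fun v => (hasDerivAt_jacobiDn hq v).continuousAt).pow 2
  exact (hc.integral_hasStrictDerivAt 0 u).hasDerivAt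

end Jacobi

/-! ### The Lamé equation -/

noncomputable section

/-- The derivative of `lameU1`. -/
def lameU1Deriv (q t : ℝ) : ℝ :=
  1 - 2 * (1 + q ^ 2) * jacobiSn t q ^ 2 + 3 * q ^ 2 * jacobiSn t q ^ 4

/-- The derivative of `lameU2`. -/
def lameU2Deriv (q t : ℝ) : ℝ :=
  jacobiCn t q * jacobiDn t q *
      ((-2 * (-2 * q ^ 6 + 3 * q ^ 4 - 5 * q ^ 2 + 2) * jacobiSn t q
          - 4 * (2 * q ^ 2 * (q ^ 4 - q ^ 2 + 1)) * jacobiSn t q * (1 - jacobiSn t q ^ 2))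
        + ((-q ^ 4 + 3 * q ^ 2 - 2)
          + 2 * (q ^ 4 - q ^ 2 + 1) * (1 - q ^ 2 * jacobiSn t q ^ 2)) * jacobiSn t q)
    + ((-q ^ 4 + 3 * q ^ 2 - 2) * t + 2 * (q ^ 4 - q ^ 2 + 1) * jacobiEpsilon t q)
      * lameU1Deriv q t

end

variable {q : ℝ}

lemma hasDerivAt_lameU1 (hq : q ^ 2 < 1) (t : ℝ) :
    HasDerivAt (lameU1 q) (lameU1Deriv q t) t := by
  refine (((hasDerivAt_jacobiSn hq t).mul (hasDerivAt_jacobiCn hq t)).mul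
    (hasDerivAt_jacobiDn hq t)).congr_deriv ?_
  simp only [lameU1Deriv, Pi.mul_apply]
  -- The product rule gives `cn² dn² - sn² dn² - q² sn² cn²`; first `dn²`, then `cn²` is eliminated.
  linear_combination (jacobiCn t q ^ 2 - jacobiSn t q ^ 2) * jacobiDn_sq hq t
    + (1 - 2 * q ^ 2 * jacobiSn t q ^ 2) * jacobiCn_sq t q

lemma hasDerivAt_lameU1Deriv (hq : q ^ 2 < 1) (t : ℝ) :
    HasDerivAt (lameU1Deriv q)
      ((12 * q ^ 2 * jacobiSn t q ^ 2 - 4 * (1 + q ^ 2)) * lameU1 q t) t := by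
  have hs := hasDerivAt_jacobiSn hq t
  refine ((((hs.pow 2).const_mul (2 * (1 + q ^ 2))).const_sub 1).add
    ((hs.pow 4).const_mul (3 * q ^ 2))).congr_deriv ?_
  simp only [lameU1]
  push_cast
  ring

lemma hasDerivAt_lameU2 (hq : q ^ 2 < 1) (t : ℝ) :
    HasDerivAt (lameU2 q) (lameU2Deriv q t) t := by
  have hc := hasDerivAt_jacobiCn hq t
  refine ((((hc.pow 2).const_mul (-2 * q ^ 6 + 3 * q ^ 4 - 5 * q ^ 2 + 2)).const_add
      (-1 + q ^ 2)).add ((hc.pow 4).const_mul (2 * q ^ 2 * (q ^ 4 - q ^ 2 + 1)))).add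
    ((((hasDerivAt_id t).const_mul (-q ^ 4 + 3 * q ^ 2 - 2)).add
      ((hasDerivAt_jacobiEpsilon hq t).const_mul (2 * (q ^ 4 - q ^ 2 + 1)))).mul
      (hasDerivAt_lameU1 hq t)) |>.congr_deriv ?_
  simp only [lameU2Deriv, lameU1, Pi.add_apply, id]
  rw [jacobiDn_sq hq t, ← jacobiCn_sq]
  push_cast
  ring

lemma hasDerivAt_lameU2Deriv (hq : q ^ 2 < 1) (t : ℝ) :
    HasDerivAt (lameU2Deriv q)
      ((12 * q ^ 2 * jacobiSn t q ^ 2 - 4 * (1 + q ^ 2)) * lameU2 q t) t := by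
  have hs := hasDerivAt_jacobiSn hq t
  refine ((((hasDerivAt_jacobiCn hq t).mul (hasDerivAt_jacobiDn hq t)).mul
    (((hs.const_mul (-2 * (-2 * q ^ 6 + 3 * q ^ 4 - 5 * q ^ 2 + 2))).sub
      ((hs.const_mul (4 * (2 * q ^ 2 * (q ^ 4 - q ^ 2 + 1)))).mul
        ((hs.pow 2).const_sub 1))).add
      (((((hs.pow 2).const_mul (q ^ 2)).const_sub 1).const_mul (2 * (q ^ 4 - q ^ 2 + 1))
        |>.const_add (-q ^ 4 + 3 * q ^ 2 - 2)).mul hs))).add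
    ((((hasDerivAt_id t).const_mul (-q ^ 4 + 3 * q ^ 2 - 2)).add
      ((hasDerivAt_jacobiEpsilon hq t).const_mul (2 * (q ^ 4 - q ^ 2 + 1)))).mul
      (hasDerivAt_lameU1Deriv hq t))).congr_deriv ?_
  have hc4 : jacobiCn t q ^ 4 = (1 - jacobiSn t q ^ 2) ^ 2 := by rw [← jacobiCn_sq]; ring
  have hd := jacobiDn_sq hq t
  have hc := jacobiCn_sq t q
  simp only [lameU1Deriv, lameU2, lameU1, Pi.add_apply, Pi.mul_apply, Pi.sub_apply, Pi.pow_apply, id, hc4]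
  rw [hd, hc]
  push_cast
  generalize jacobiSn t q = s at *
  generalize jacobiCn t q = c at *
  generalize jacobiDn t q = d at *
  generalize jacobiEpsilon t q = E at *
  -- `R` is the cofactor of `cn dn` in `lameU2Deriv`, and `R' = dR/ds`. Hence `(c d R)' = -s d² R -
  -- q² s c² R + c² d² R'`, which dictates the coefficients below.
  set R := (-2 * (-2 * q ^ 6 + 3 * q ^ 4 - 5 * q ^ 2 + 2) * s - 4 * (2 * q ^ 2 * (q ^ 4 - q ^ 2 + 1)) * s * (1 - s ^ 2)
      + ((-q ^ 4 + 3 * q ^ 2 - 2) + (2 * (q ^ 4 - q ^ 2 + 1)) * (1 - q ^ 2 * s ^ 2)) * s) with hR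
  set R' := (-2 * (-2 * q ^ 6 + 3 * q ^ 4 - 5 * q ^ 2 + 2) - 4 * (2 * q ^ 2 * (q ^ 4 - q ^ 2 + 1)) + 12 * (2 * q ^ 2 * (q ^ 4 - q ^ 2 + 1)) * s ^ 2
      + (-q ^ 4 + 3 * q ^ 2 - 2) + (2 * (q ^ 4 - q ^ 2 + 1)) - 3 * (2 * (q ^ 4 - q ^ 2 + 1)) * q ^ 2 * s ^ 2) with hR'
  linear_combination (-s * R + c ^ 2 * R') * hd
    + (-q ^ 2 * s * R + (1 - q ^ 2 * s ^ 2) * R') * hc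

/-- Writing `u₂ = p + L u₁` with `L` the combination of `t` and `𝓔`, the terms in `L` cancel and a
polynomial identity in `sn²` remains. -/
lemma lame_wronskian (hq : q ^ 2 < 1) (t : ℝ) :
    lameU1 q t * lameU2Deriv q t - lameU1Deriv q t * lameU2 q t = -(1 - q ^ 2) ^ 2 := by
  have hc4 : jacobiCn t q ^ 4 = (1 - jacobiSn t q ^ 2) ^ 2 := by rw [← jacobiCn_sq]; ring
  have hd := jacobiDn_sq hq t
  have hc := jacobiCn_sq t q
  simp only [lameU1Deriv, lameU2Deriv, lameU2, lameU1, hc4]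
  rw [hc]
  generalize jacobiSn t q = s at *
  generalize jacobiCn t q = c at *
  generalize jacobiDn t q = d at *
  generalize jacobiEpsilon t q = E at *
  set R := (-2 * (-2 * q ^ 6 + 3 * q ^ 4 - 5 * q ^ 2 + 2) * s - 4 * (2 * q ^ 2 * (q ^ 4 - q ^ 2 + 1)) * s * (1 - s ^ 2)
      + ((-q ^ 4 + 3 * q ^ 2 - 2) + (2 * (q ^ 4 - q ^ 2 + 1)) * (1 - q ^ 2 * s ^ 2)) * s) with hR
  linear_combination (s * R * c ^ 2) * hd + (s * R * (1 - q ^ 2 * s ^ 2)) * hc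

/-! ### Variation of constants -/

/-- `w₁`, `w₂` are solutions of `w'' = p w` on `ℝ`, with derivatives `v₁`, `v₂` and
Wronskian `1`. -/
structure IsFundamentalPair (p w₁ v₁ w₂ v₂ : ℝ → ℝ) : Prop where
  fst : ∀ t, HasDerivAt w₁ (v₁ t) t
  fst_deriv : ∀ t, HasDerivAt v₁ (p t * w₁ t) t
  snd : ∀ t, HasDerivAt w₂ (v₂ t) t
  snd_deriv : ∀ t, HasDerivAt v₂ (p t * w₂ t) t
  wronskian : ∀ t, w₁ t * v₂ t - v₁ t * w₂ t = 1

namespace IsFundamentalPair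

variable {p w₁ v₁ w₂ v₂ f z ξ : ℝ → ℝ}

lemma continuous_fst (h : IsFundamentalPair p w₁ v₁ w₂ v₂) : Continuous w₁ :=
  continuous_iff_continuousAt.2 fun t => (h.fst t).continuousAt

lemma continuous_snd (h : IsFundamentalPair p w₁ v₁ w₂ v₂) : Continuous w₂ :=
  continuous_iff_continuousAt.2 fun t => (h.snd t).continuousAt

lemma continuous_fst_deriv (h : IsFundamentalPair p w₁ v₁ w₂ v₂) : Continuous v₁ :=
  continuous_iff_continuousAt.2 fun t => (h.fst_deriv t).continuousAt

lemma continuous_snd_deriv (h : IsFundamentalPair p w₁ v₁ w₂ v₂) : Continuous v₂ :=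
  continuous_iff_continuousAt.2 fun t => (h.snd_deriv t).continuousAt

end IsFundamentalPair

/-- Lagrange's identity: in the derivative of `w ξ - v z` the potential terms cancel, leaving `w f`.
-/
lemma mul_sub_mul_eq_integral {p w v f z ξ : ℝ → ℝ}
    (hw : ∀ t, HasDerivAt w (v t) t) (hv : ∀ t, HasDerivAt v (p t * w t) t)
    (hf : Continuous f) (hz0 : z 0 = 0) (hξ0 : ξ 0 = 0)
    (hz : ∀ t, 0 ≤ t → HasDerivWithinAt z (ξ t) (Set.Ici 0) t)
    (hξ : ∀ t, 0 ≤ t → HasDerivWithinAt ξ (p t * z t + f t) (Set.Ici 0) t)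
    {t : ℝ} (ht : 0 ≤ t) :
    w t * ξ t - v t * z t = ∫ s in (0 : ℝ)..t, w s * f s := by
  have hwc : Continuous w := continuous_iff_continuousAt.2 fun t => (hw t).continuousAt
  have hd : ∀ s, 0 ≤ s →
      HasDerivWithinAt (fun s => w s * ξ s - v s * z s) (w s * f s) (Set.Ici 0) s := by
    intro s hs
    refine (((hw s).hasDerivWithinAt.mul (hξ s hs)).sub
      ((hv s).hasDerivWithinAt.mul (hz s hs))).congr_deriv ?_
    ring
  have h := intervalIntegral.integral_eq_sub_of_hasDeriv_right_of_le ht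
    (f := fun s => w s * ξ s - v s * z s) (f' := fun s => w s * f s)
    (fun s hs => ((hd s hs.1).continuousWithinAt).mono fun r hr => hr.1)
    (fun s hs => (hd s hs.1.le).mono fun r hr => hs.1.le.trans (le_of_lt hr))
    ((hwc.mul hf).intervalIntegrable 0 t)
  rw [h, hz0, hξ0]
  ring

namespace IsFundamentalPair

variable {p w₁ v₁ w₂ v₂ f z ξ : ℝ → ℝ}

/-- A solution of `z'' = p z + f` with zero initial data is given by variation of constants. -/
lemma eq_variation_of_constants (h : IsFundamentalPair p w₁ v₁ w₂ v₂)
    (hf : Continuous f) (hz0 : z 0 = 0) (hξ0 : ξ 0 = 0)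
    (hz : ∀ t, 0 ≤ t → HasDerivWithinAt z (ξ t) (Set.Ici 0) t)
    (hξ : ∀ t, 0 ≤ t → HasDerivWithinAt ξ (p t * z t + f t) (Set.Ici 0) t)
    {t : ℝ} (ht : 0 ≤ t) :
    z t = w₂ t * (∫ s in (0 : ℝ)..t, w₁ s * f s) - w₁ t * ∫ s in (0 : ℝ)..t, w₂ s * f s := by
  rw [← mul_sub_mul_eq_integral h.fst h.fst_deriv hf hz0 hξ0 hz hξ ht,
    ← mul_sub_mul_eq_integral h.snd h.snd_deriv hf hz0 hξ0 hz hξ ht]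
  -- Cramer's rule: `w₂ (w₁ ξ - v₁ z) - w₁ (w₂ ξ - v₂ z) = (w₁ v₂ - v₁ w₂) z = z`.
  linear_combination (-z t) * h.wronskian t

/-- The kernel vanishes on the diagonal, so `f` does not appear yet; at the second derivative it
appears with the Wronskian as its factor. -/
lemma hasDerivAt_variation_of_constants (h : IsFundamentalPair p w₁ v₁ w₂ v₂)
    (hf : Continuous f) (t : ℝ) :
    HasDerivAt (fun t => w₂ t * (∫ s in (0 : ℝ)..t, w₁ s * f s)
        - w₁ t * ∫ s in (0 : ℝ)..t, w₂ s * f s)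
      (v₂ t * (∫ s in (0 : ℝ)..t, w₁ s * f s) - v₁ t * ∫ s in (0 : ℝ)..t, w₂ s * f s) t := by
  have h1 := ((h.continuous_fst.mul hf).integral_hasStrictDerivAt 0 t).hasDerivAt
  have h2 := ((h.continuous_snd.mul hf).integral_hasStrictDerivAt 0 t).hasDerivAt
  refine (((h.snd t).mul h1).sub ((h.fst t).mul h2)).congr_deriv ?_
  simp only [Pi.mul_apply]
  ring

lemma hasDerivAt_variation_of_constants_deriv (h : IsFundamentalPair p w₁ v₁ w₂ v₂)
    (hf : Continuous f) (t : ℝ) :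
    HasDerivAt (fun t => v₂ t * (∫ s in (0 : ℝ)..t, w₁ s * f s)
        - v₁ t * ∫ s in (0 : ℝ)..t, w₂ s * f s)
      (p t * (w₂ t * (∫ s in (0 : ℝ)..t, w₁ s * f s)
        - w₁ t * ∫ s in (0 : ℝ)..t, w₂ s * f s) + f t) t := by
  have h1 := ((h.continuous_fst.mul hf).integral_hasStrictDerivAt 0 t).hasDerivAt
  have h2 := ((h.continuous_snd.mul hf).integral_hasStrictDerivAt 0 t).hasDerivAt
  refine (((h.snd_deriv t).mul h1).sub ((h.fst_deriv t).mul h2)).congr_deriv ?_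
  simp only [Pi.mul_apply]
  linear_combination f t * h.wronskian t

/-- Variation of constants for the system `z' = η + β`, `η' = p z`: the derivative of `z`. -/
lemma hasDerivAt_variation_of_constants_by_parts (h : IsFundamentalPair p w₁ v₁ w₂ v₂)
    {β : ℝ → ℝ} (hβ : Continuous β) (t : ℝ) :
    HasDerivAt (fun t => w₁ t * (∫ s in (0 : ℝ)..t, v₂ s * β s)
        - w₂ t * ∫ s in (0 : ℝ)..t, v₁ s * β s)
      (v₁ t * (∫ s in (0 : ℝ)..t, v₂ s * β s)
        - v₂ t * (∫ s in (0 : ℝ)..t, v₁ s * β s) + β t) t := by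
  have h1 := ((h.continuous_fst_deriv.mul hβ).integral_hasStrictDerivAt 0 t).hasDerivAt
  have h2 := ((h.continuous_snd_deriv.mul hβ).integral_hasStrictDerivAt 0 t).hasDerivAt
  refine (((h.fst t).mul h2).sub ((h.snd t).mul h1)).congr_deriv ?_
  simp only [Pi.mul_apply]
  linear_combination β t * h.wronskian t

/-- Variation of constants for the system `z' = η + β`, `η' = p z`: the derivative of `η`. -/
lemma hasDerivAt_variation_of_constants_by_parts_deriv
    (h : IsFundamentalPair p w₁ v₁ w₂ v₂) {β : ℝ → ℝ} (hβ : Continuous β) (t : ℝ) :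
    HasDerivAt (fun t => v₁ t * (∫ s in (0 : ℝ)..t, v₂ s * β s)
        - v₂ t * ∫ s in (0 : ℝ)..t, v₁ s * β s)
      (p t * (w₁ t * (∫ s in (0 : ℝ)..t, v₂ s * β s)
        - w₂ t * ∫ s in (0 : ℝ)..t, v₁ s * β s)) t := by
  have h1 := ((h.continuous_fst_deriv.mul hβ).integral_hasStrictDerivAt 0 t).hasDerivAt
  have h2 := ((h.continuous_snd_deriv.mul hβ).integral_hasStrictDerivAt 0 t).hasDerivAt
  refine (((h.fst_deriv t).mul h2).sub ((h.snd_deriv t).mul h1)).congr_deriv ?_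
  simp only [Pi.mul_apply]
  ring

end IsFundamentalPair

/-! ### The fundamental pair `(w₁, w₂)` -/

section Parameters

variable {a c : ℝ}

lemma sq_modulus (hac : 2 * c + a < 0) (hc : c - a < 0) :
    modulus a c ^ 2 = (2 * c + a) / (c - a) :=
  Real.sq_sqrt (div_nonneg_of_nonpos hac.le hc.le)

/-- Since `c - a < 0`, the bound amounts to `-a - c < a`, the ordering of the two upper roots of the
cubic. -/
lemma sq_modulus_lt_one (hac : 2 * c + a < 0) (hc : c - a < 0) (hca : -a - c < a) :
    modulus a c ^ 2 < 1 := by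
  rw [sq_modulus hac hc, div_lt_one_of_neg hc]
  linarith

lemma sq_freq (hc : c - a < 0) : freq a c ^ 2 = (a - c) / 6 :=
  Real.sq_sqrt (by linarith)

lemma sq_freq_mul_potential (hac : 2 * c + a < 0) (hc : c - a < 0) (y t : ℝ) :
    freq a c ^ 2 * (12 * modulus a c ^ 2
      * jacobiSn (freq a c * t + phase a c y) (modulus a c) ^ 2 - 4 * (1 + modulus a c ^ 2))
      = 2 * xZero a c y t := by
  have h0 : c - a ≠ 0 := hc.ne
  rw [xZero]
  generalize jacobiSn (freq a c * t + phase a c y) (modulus a c) = s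
  rw [sq_freq hc, sq_modulus hac hc]
  field_simp
  ring

lemma isFundamentalPair_wOne_wTwo (hac : 2 * c + a < 0) (hc : c - a < 0) (hca : -a - c < a)
    (y : ℝ) {k₁ k₂ : ℝ} (hk : WronskianNormalized a c k₁ k₂) :
    IsFundamentalPair (fun t => 2 * xZero a c y t)
      (wOne a c y k₁)
      (fun t => k₁ * (freq a c * lameU1Deriv (modulus a c) (freq a c * t + phase a c y)))
      (wTwo a c y k₂)
      (fun t => k₂ * (freq a c * lameU2Deriv (modulus a c) (freq a c * t + phase a c y))) := by
  have hq := sq_modulus_lt_one hac hc hca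
  have haff : ∀ t, HasDerivAt (fun t => freq a c * t + phase a c y) (freq a c) t := fun t => by
    simpa using ((hasDerivAt_id t).const_mul (freq a c)).add_const (phase a c y)
  refine ⟨fun t => ?_, fun t => ?_, fun t => ?_, fun t => ?_, fun t => ?_⟩
  · refine (((hasDerivAt_lameU1 hq _).comp t (haff t)).const_mul k₁).congr_deriv ?_
    ring
  · refine ((((hasDerivAt_lameU1Deriv hq _).comp t (haff t)).const_mul
      (freq a c)).const_mul k₁).congr_deriv ?_
    rw [← sq_freq_mul_potential hac hc, wOne]
    ring
  · refine (((hasDerivAt_lameU2 hq _).comp t (haff t)).const_mul k₂).congr_deriv ?_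
    ring
  · refine ((((hasDerivAt_lameU2Deriv hq _).comp t (haff t)).const_mul
      (freq a c)).const_mul k₂).congr_deriv ?_
    rw [← sq_freq_mul_potential hac hc, wTwo]
    ring
  · rw [WronskianNormalized] at hk
    rw [wOne, wTwo, ← hk]
    linear_combination k₁ * k₂ * freq a c * lame_wronskian hq (freq a c * t + phase a c y)

end Parameters

/-! ### Adapted processes -/

variable {Ω : Type*} {mΩ : MeasurableSpace Ω} {𝓕 : Filtration ℝ≥0 mΩ} {P : Measure Ω}
  {X : ℝ≥0 → Ω → ℝ}

lemma path_coe (X : ℝ≥0 → Ω → ℝ) (ω : Ω) (t : ℝ≥0) : path X ω t = X t ω := by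
  simp [path]

lemma continuous_path_iff {ω : Ω} : Continuous (path X ω) ↔ Continuous fun t => X t ω := by
  refine ⟨fun h => ?_, fun h => h.comp continuous_real_toNNReal⟩
  simpa [path, Function.comp_def] using h.comp NNReal.continuous_coe

lemma continuous_of_hasDerivWithinAt_path {ω : Ω} {f : ℝ≥0 → ℝ}
    (h : ∀ t : ℝ≥0, HasDerivWithinAt (path X ω) (f t) (Set.Ici 0) t) :
    Continuous fun t => X t ω := by
  have hc : ContinuousOn (path X ω) (Set.Ici 0) := fun t ht =>
    (h ⟨t, ht⟩).continuousWithinAt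
  have := hc.comp_continuous NNReal.continuous_coe fun t => t.2
  simpa [path, Function.comp_def] using this

/-- The time integral of an adapted process with continuous paths is adapted. -/
lemma adapted_integral (hX : Adapted 𝓕 X) (hc : ∀ ω, Continuous fun t => X t ω) {g : ℝ → ℝ}
    (hg : Continuous g) :
    Adapted 𝓕 fun t ω => ∫ s in (0 : ℝ)..t, g s * path X ω s := by
  intro t
  have hm : @Measurable (ℝ × Ω) ℝ (@Prod.instMeasurableSpace ℝ Ω _ (𝓕 t)) _
      -- Stopping at time `t` makes the integrand `𝓕 t`-measurable in `ω` for every real `s`,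
      -- without changing it on `(0, t]`; continuity in `s` then gives joint measurability.
      (Function.uncurry fun (s : ℝ) ω => g s * X (min s.toNNReal t) ω) := by
    refine @measurable_uncurry_of_continuous_of_measurable Ω ℝ ℝ _ _ _ _ _ _ _ _ _ (𝓕 t) _
      (fun ω => ?_) fun s => ?_
    · exact hg.mul ((hc ω).comp (continuous_real_toNNReal.min continuous_const))
    · exact ((hX (min s.toNNReal t)).mono (𝓕.mono (min_le_right _ _)) le_rfl).const_mul (g s)
  have hi := (@StronglyMeasurable.integral_prod_left ℝ Ω ℝ _ (𝓕 t) (volume.restrict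
    (Set.Ioc (0 : ℝ) t)) _ _ _ _ hm.stronglyMeasurable).measurable
  convert hi using 2 with ω
  simp only [intervalIntegral.integral_of_le t.coe_nonneg]
  refine setIntegral_congr_fun measurableSet_Ioc fun s hs => ?_
  have : s.toNNReal ≤ t := Real.toNNReal_le_iff_le_coe.2 hs.2
  simp [path, min_eq_left this]

/-- An adapted process with almost surely continuous paths is indistinguishable from an adapted
process all of whose paths are continuous, if the filtration contains the null events. -/
lemma exists_adapted_continuous (h𝓕 : ∀ N, MeasurableSet N → P N = 0 → ∀ t, MeasurableSet[𝓕 t] N)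
    (hX : Adapted 𝓕 X) (hc : ∀ᵐ ω ∂P, Continuous fun t => X t ω) :
    ∃ Y : ℝ≥0 → Ω → ℝ, Adapted 𝓕 Y ∧ (∀ ω, Continuous fun t => Y t ω) ∧
      ∀ᵐ ω ∂P, ∀ t, Y t ω = X t ω := by
  obtain ⟨N, hsub, hN, hN0⟩ := exists_measurable_superset_of_null (ae_iff.1 hc)
  -- Bad paths are set to zero on a measurable null event, which belongs to every `𝓕 t`.
  refine ⟨fun t => Nᶜ.indicator (X t), fun t => (hX t).indicator (h𝓕 N hN hN0 t).compl,
    fun ω => ?_, ?_⟩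
  · by_cases hω : ω ∈ N
    · simpa [hω] using continuous_const
    · simpa [hω] using not_not.1 fun h => hω (hsub h)
  · filter_upwards [measure_eq_zero_iff_ae_notMem.1 hN0] with ω hω t
    simp [hω]

lemma measurableSet_brownianFiltration_of_null {B : ℝ≥0 → Ω → ℝ} (hB : ∀ t, Measurable (B t))
    (N : Set Ω) (hN : MeasurableSet N) (hN0 : P N = 0) (t : ℝ≥0) :
    MeasurableSet[brownianFiltration B hB P t] N := by
  have h : MeasurableSpace.generateFrom {N | MeasurableSet N ∧ P N = 0}
      ≤ brownianFiltration B hB P t := le_sup_right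
  exact h N (MeasurableSpace.measurableSet_generateFrom ⟨hN, hN0⟩)

lemma adapted_brownianFiltration {B : ℝ≥0 → Ω → ℝ} (hB : ∀ t, Measurable (B t)) :
    Adapted (brownianFiltration B hB P) B := by
  intro t
  have h : MeasurableSpace.comap (B t) inferInstance ≤ brownianFiltration B hB P t :=
    le_sup_of_le_left (le_iSup₂_of_le (f := fun s (_ : s ≤ t) =>
      MeasurableSpace.comap (B s) inferInstance) t le_rfl le_rfl)
  exact (comap_measurable (B t)).mono h le_rfl

/-! ### Strong solutions -/

variable {x₀ w₁ v₁ w₂ v₂ : ℝ → ℝ} {B : ℝ≥0 → Ω → ℝ} {x : ℕ → ℝ≥0 → Ω → ℝ} {n : ℕ}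

lemma IsStrongSolutionOne.ae_continuous {z : ℝ≥0 → Ω → ℝ}
    (h : IsStrongSolutionOne 𝓕 P x₀ B z) : ∀ᵐ ω ∂P, Continuous fun t => z t ω := by
  obtain ⟨-, ξ, -, h⟩ := h
  filter_upwards [h] with ω hω using continuous_of_hasDerivWithinAt_path hω.2.2.1

lemma IsStrongSolution.ae_continuous {z : ℝ≥0 → Ω → ℝ}
    (h : IsStrongSolution 𝓕 P x₀ n x z) : ∀ᵐ ω ∂P, Continuous fun t => z t ω := by
  obtain ⟨-, ξ, -, h⟩ := h
  filter_upwards [h] with ω hω using continuous_of_hasDerivWithinAt_path hω.2.2.1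

lemma IsCoefficientFamilyBelow.adapted (h : IsCoefficientFamilyBelow 𝓕 P x₀ B n x) {j : ℕ}
    (hj : 1 ≤ j) (hjn : j < n) : Adapted 𝓕 (x j) := by
  rcases hj.eq_or_lt with rfl | hj
  · exact h.1.1
  · exact (h.2 j hj hjn).1

lemma IsCoefficientFamilyBelow.ae_continuous (h : IsCoefficientFamilyBelow 𝓕 P x₀ B n x) {j : ℕ}
    (hj : 1 ≤ j) (hjn : j < n) : ∀ᵐ ω ∂P, Continuous fun t => x j t ω := by
  rcases hj.eq_or_lt with rfl | hj
  · exact h.1.ae_continuous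
  · exact (h.2 j hj hjn).ae_continuous

lemma IsCoefficientFamilyBelow.adapted_forcing (h : IsCoefficientFamilyBelow 𝓕 P x₀ B n x) :
    Adapted 𝓕 fun t ω => forcing n x ω t := by
  intro t
  refine Finset.measurable_sum _ fun j hj => ?_
  rw [Finset.mem_Ico] at hj
  simp only [path_coe]
  exact (h.adapted hj.1 hj.2 t).mul (h.adapted (by lia) (by lia) t)

lemma IsCoefficientFamilyBelow.ae_continuous_forcing
    (h : IsCoefficientFamilyBelow 𝓕 P x₀ B n x) :
    ∀ᵐ ω ∂P, Continuous fun t => forcing n x ω t := by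
  have hc : ∀ᵐ ω ∂P, ∀ j ∈ Finset.Ico 1 n, Continuous fun t => x j t ω :=
    (Finset.Ico 1 n).eventually_all.2 fun j hj =>
      h.ae_continuous (Finset.mem_Ico.1 hj).1 (Finset.mem_Ico.1 hj).2
  filter_upwards [hc] with ω hω
  refine continuous_finsetSum _ fun j hj => ?_
  have hj' : n - j ∈ Finset.Ico 1 n := by rw [Finset.mem_Ico] at hj ⊢; lia
  exact (continuous_path_iff.2 (hω j hj)).mul (continuous_path_iff.2 (hω _ hj'))

/-- The formula `f` lives on all of `ℝ`, but `path X ω`, frozen for negative times, need agree with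
it only on `[0, ∞)`; hence the one-sided derivative. -/
lemma hasDerivWithinAt_path {ω : Ω} {f : ℝ → ℝ} {f' : ℝ} {t : ℝ≥0}
    (hX : ∀ s : ℝ≥0, X s ω = f s) (hf : HasDerivAt f f' t) :
    HasDerivWithinAt (path X ω) f' (Set.Ici 0) t := by
  refine hf.hasDerivWithinAt.congr (fun s hs => ?_) ?_
  · rw [path, hX, Real.coe_toNNReal s hs]
  · rw [path_coe, hX]

/-- Existence of the first-order process. -/
theorem exists_isStrongSolutionOne
    (h𝓕 : ∀ N, MeasurableSet N → P N = 0 → ∀ t, MeasurableSet[𝓕 t] N)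
    (hw : IsFundamentalPair (fun t => 2 * x₀ t) w₁ v₁ w₂ v₂) (hx₀ : Continuous x₀)
    (hB : Adapted 𝓕 B) (hBc : ∀ᵐ ω ∂P, Continuous fun t => B t ω) :
    ∃ z, IsStrongSolutionOne 𝓕 P x₀ B z := by
  obtain ⟨β, hβ, hβc, hβB⟩ := exists_adapted_continuous h𝓕 (X := fun t ω => B t ω - B 0 ω)
    (fun t => (hB t).sub ((hB 0).mono (𝓕.mono zero_le) le_rfl))
    (hBc.mono fun ω h => h.sub continuous_const)
  have h1 := adapted_integral hβ hβc hw.continuous_fst_deriv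
  have h2 := adapted_integral hβ hβc hw.continuous_snd_deriv
  -- Formally `∫ K(t, s) dB_s = -∫ ∂ₛK(t, s) β_s ds`, as `K(t, t) = 0` and `β_0 = 0` almost surely.
  -- With velocity `ξ = η + β`, the remainder `η` solves `η' = 2 x₀ z` without noise.
  let z : ℝ≥0 → Ω → ℝ := fun t ω => w₁ t * (∫ s in (0 : ℝ)..t, v₂ s * path β ω s)
    - w₂ t * ∫ s in (0 : ℝ)..t, v₁ s * path β ω s
  let η : ℝ≥0 → Ω → ℝ := fun t ω => v₁ t * (∫ s in (0 : ℝ)..t, v₂ s * path β ω s)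
    - v₂ t * ∫ s in (0 : ℝ)..t, v₁ s * path β ω s
  refine ⟨z, fun t => ((h2 t).const_mul (w₁ t)).sub ((h1 t).const_mul (w₂ t)),
    fun t ω => η t ω + β t ω,
    fun t => (((h2 t).const_mul (v₁ t)).sub ((h1 t).const_mul (v₂ t))).add (hβ t), ?_⟩
  filter_upwards [hβB] with ω hω
  have hpc : Continuous (path β ω) := continuous_path_iff.2 (hβc ω)
  refine ⟨by simp [z], by simp [η, hω], fun t => ?_, fun t => ?_⟩
  · have := hw.hasDerivAt_variation_of_constants_by_parts hpc t
    rw [path_coe] at this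
    exact hasDerivWithinAt_path (fun s => rfl) this
  · rw [hω, add_left_inj]
    have hz := continuous_iff_continuousAt.2 fun t =>
      (hw.hasDerivAt_variation_of_constants_by_parts hpc t).continuousAt
    have hint := intervalIntegral.integral_eq_sub_of_hasDerivAt (a := 0) (b := t)
      (fun s _ => hw.hasDerivAt_variation_of_constants_by_parts_deriv hpc s)
      (((continuous_const.mul hx₀).mul hz).intervalIntegrable _ _)
    simp only [intervalIntegral.integral_same, mul_zero, sub_zero] at hint
    rw [show η t ω = _ from hint.symm]
    refine intervalIntegral.integral_congr fun s hs => ?_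
    rw [Set.uIcc_of_le t.coe_nonneg] at hs
    simp only [path, z, Real.coe_toNNReal s hs.1]

/-- Existence for the equation of order `n`. -/
theorem IsCoefficientFamilyBelow.exists_isStrongSolution
    (h𝓕 : ∀ N, MeasurableSet N → P N = 0 → ∀ t, MeasurableSet[𝓕 t] N)
    (hw : IsFundamentalPair (fun t => 2 * x₀ t) w₁ v₁ w₂ v₂)
    (h : IsCoefficientFamilyBelow 𝓕 P x₀ B n x) :
    ∃ z, IsStrongSolution 𝓕 P x₀ n x z := by
  -- The forcing is only almost surely continuous, while `adapted_integral` requires every path to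
  -- be.
  obtain ⟨F, hF, hFc, hFx⟩ := exists_adapted_continuous h𝓕 h.adapted_forcing
    (h.ae_continuous_forcing.mono fun ω hω => hω.comp NNReal.continuous_coe)
  have h1 := adapted_integral hF hFc hw.continuous_fst
  have h2 := adapted_integral hF hFc hw.continuous_snd
  refine ⟨fun t ω => w₂ t * (∫ s in (0 : ℝ)..t, w₁ s * path F ω s)
      - w₁ t * ∫ s in (0 : ℝ)..t, w₂ s * path F ω s,
    fun t => ((h1 t).const_mul (w₂ t)).sub ((h2 t).const_mul (w₁ t)),
    fun t ω => v₂ t * (∫ s in (0 : ℝ)..t, w₁ s * path F ω s)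
      - v₁ t * ∫ s in (0 : ℝ)..t, w₂ s * path F ω s,
    fun t => ((h1 t).const_mul (v₂ t)).sub ((h2 t).const_mul (v₁ t)), ?_⟩
  filter_upwards [hFx] with ω hω
  have hpc : Continuous (path F ω) := continuous_path_iff.2 (hFc ω)
  refine ⟨by simp, by simp, fun t => ?_, fun t => ?_⟩
  · exact hasDerivWithinAt_path (fun s => rfl) (hw.hasDerivAt_variation_of_constants hpc t)
  · rw [← hω t, ← path_coe F]
    exact hasDerivWithinAt_path (fun s => rfl) (hw.hasDerivAt_variation_of_constants_deriv hpc t)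

/-- The variation of constants formula for the equation of order `n`. -/
theorem IsCoefficientFamilyBelow.ae_eq_variation_of_constants
    (hw : IsFundamentalPair (fun t => 2 * x₀ t) w₁ v₁ w₂ v₂)
    (h : IsCoefficientFamilyBelow 𝓕 P x₀ B n x) {z : ℝ≥0 → Ω → ℝ}
    (hz : IsStrongSolution 𝓕 P x₀ n x z) :
    ∀ᵐ ω ∂P, ∀ t : ℝ≥0, z t ω = w₂ t * (∫ s in (0 : ℝ)..t, w₁ s * forcing n x ω s)
      - w₁ t * ∫ s in (0 : ℝ)..t, w₂ s * forcing n x ω s := by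
  obtain ⟨-, ξ, -, hz⟩ := hz
  filter_upwards [hz, h.ae_continuous_forcing] with ω hω hf t
  obtain ⟨hz0, hξ0, hz, hξ⟩ := hω
  rw [← path_coe z]
  refine hw.eq_variation_of_constants (ξ := path ξ ω) hf ?_ ?_ (fun s hs => ?_) (fun s hs => ?_) t.2
  · simpa [path] using hz0
  · simpa [path] using hξ0
  · lift s to ℝ≥0 using hs
    rw [path_coe]
    exact hz s
  · lift s to ℝ≥0 using hs
    rw [path_coe]
    exact hξ s

/-- For `1 ≤ j < n` also `n - j < n`, so choosing the process of order `n` disturbs no equation of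
order at most `n`. -/
lemma forcing_congr {x' : ℕ → ℝ≥0 → Ω → ℝ} (h : ∀ j < n, x j = x' j) :
    forcing n x = forcing n x' := by
  ext ω s
  refine Finset.sum_congr rfl fun j hj => ?_
  rw [Finset.mem_Ico] at hj
  rw [h j hj.2, h (n - j) (by lia)]

lemma isStrongSolution_congr {x' : ℕ → ℝ≥0 → Ω → ℝ} (h : ∀ j < n, x j = x' j)
    {z : ℝ≥0 → Ω → ℝ} :
    IsStrongSolution 𝓕 P x₀ n x z ↔ IsStrongSolution 𝓕 P x₀ n x' z := by
  simp only [IsStrongSolution, forcing_congr h]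

/-- Existence of the coefficient processes of order below `n`. -/
theorem exists_isCoefficientFamilyBelow
    (h𝓕 : ∀ N, MeasurableSet N → P N = 0 → ∀ t, MeasurableSet[𝓕 t] N)
    (hw : IsFundamentalPair (fun t => 2 * x₀ t) w₁ v₁ w₂ v₂) (hx₀ : Continuous x₀)
    (hB : Adapted 𝓕 B) (hBc : ∀ᵐ ω ∂P, Continuous fun t => B t ω) (hn : 2 ≤ n) :
    ∃ x, IsCoefficientFamilyBelow 𝓕 P x₀ B n x := by
  induction n, hn using Nat.le_induction with
  | base =>
    obtain ⟨z, hz⟩ := exists_isStrongSolutionOne h𝓕 hw hx₀ hB hBc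
    -- Below order two only `x 1` is constrained; the other entries are arbitrary.
    exact ⟨fun _ => z, hz, fun m h2 hm => by lia⟩
  | succ n hn ih =>
    obtain ⟨x, hx⟩ := ih
    obtain ⟨z, hz⟩ := hx.exists_isStrongSolution h𝓕 hw
    refine ⟨Function.update x n z, ?_, fun m h2 hm => ?_⟩
    · rw [Function.update_of_ne (by lia)]
      exact hx.1
    · rw [← isStrongSolution_congr (x := x)
        fun j hj => (Function.update_of_ne (by lia) _ _).symm]
      rcases (Nat.lt_succ_iff.1 hm).eq_or_lt with rfl | hm
      · simpa using hz
      · rw [Function.update_of_ne hm.ne]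
        exact hx.2 m h2 hm

lemma continuous_xZero {a c : ℝ} (hq : modulus a c ^ 2 < 1) (y : ℝ) :
    Continuous (xZero a c y) := by
  have hs : Continuous fun u => jacobiSn u (modulus a c) :=
    continuous_iff_continuousAt.2 fun u => (hasDerivAt_jacobiSn hq u).continuousAt
  exact continuous_const.sub (continuous_const.mul
    ((hs.comp ((continuous_const.mul continuous_id).add continuous_const)).pow 2))

end LameExpansion

theorem mainTheorem6 {Ω : Type*} {mΩ : MeasurableSpace Ω} (P : Measure Ω) [IsProbabilityMeasure P]
    (B : ℝ≥0 → Ω → ℝ) (hBm : ∀ t, Measurable (B t)) (hB : IsBrownianReal B P)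
    (a c y : ℝ) (hc : c < 0) (ha : 0 < a) (hac : 2 * c + a < 0) (hca : -a - c < a)
    (hy : y ∈ Set.Icc c (-a - c))
    (k₁ k₂ : ℝ) (hk : LameExpansion.WronskianNormalized a c k₁ k₂)
    (n : ℕ) (hn : 2 ≤ n) :
    -- the processes of lower order, on which the equation depends, exist
    (∃ x : ℕ → ℝ≥0 → Ω → ℝ, LameExpansion.IsCoefficientFamilyBelow
      (LameExpansion.brownianFiltration B hBm P) P (LameExpansion.xZero a c y) B n x) ∧
    ∀ x : ℕ → ℝ≥0 → Ω → ℝ,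
      LameExpansion.IsCoefficientFamilyBelow
        (LameExpansion.brownianFiltration B hBm P) P (LameExpansion.xZero a c y) B n x →
      -- existence
      (∃ z : ℝ≥0 → Ω → ℝ, LameExpansion.IsStrongSolution
        (LameExpansion.brownianFiltration B hBm P) P (LameExpansion.xZero a c y) n x z) ∧
      -- uniqueness, up to indistinguishability
      (∀ z z' : ℝ≥0 → Ω → ℝ,
        LameExpansion.IsStrongSolution
          (LameExpansion.brownianFiltration B hBm P) P (LameExpansion.xZero a c y) n x z →
        LameExpansion.IsStrongSolution
          (LameExpansion.brownianFiltration B hBm P) P (LameExpansion.xZero a c y) n x z' →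
        ∀ᵐ ω ∂P, ∀ t : ℝ≥0, z t ω = z' t ω) ∧
      -- the two forms of the explicit representation
      (∀ z : ℝ≥0 → Ω → ℝ,
        LameExpansion.IsStrongSolution
          (LameExpansion.brownianFiltration B hBm P) P (LameExpansion.xZero a c y) n x z →
        ∀ᵐ ω ∂P, ∀ t : ℝ≥0,
          z t ω = LameExpansion.wTwo a c y k₂ t *
              (∫ s in (0 : ℝ)..t, LameExpansion.wOne a c y k₁ s * LameExpansion.forcing n x ω s)
            - LameExpansion.wOne a c y k₁ t *
              (∫ s in (0 : ℝ)..t, LameExpansion.wTwo a c y k₂ s * LameExpansion.forcing n x ω s) ∧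
          z t ω =
            ∫ s in (0 : ℝ)..t, LameExpansion.kernelK a c y k₁ k₂ t s *
              LameExpansion.forcing n x ω s) := by
  have hca' : c - a < 0 := by linarith
  have hw := LameExpansion.isFundamentalPair_wOne_wTwo hac hca' hca y hk
  have h𝓕 := LameExpansion.measurableSet_brownianFiltration_of_null (P := P) hBm
  refine ⟨LameExpansion.exists_isCoefficientFamilyBelow h𝓕 hw
    (LameExpansion.continuous_xZero (LameExpansion.sq_modulus_lt_one hac hca' hca) y)
    (LameExpansion.adapted_brownianFiltration hBm) hB.cont hn, fun x hx => ⟨?_, ?_, ?_⟩⟩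
  · exact hx.exists_isStrongSolution h𝓕 hw
  · intro z z' hz hz'
    -- Both solutions equal the same explicit expression off a null event that does not depend on
    -- `t`.
    filter_upwards [hx.ae_eq_variation_of_constants hw hz,
      hx.ae_eq_variation_of_constants hw hz'] with ω h h' t
    rw [h, h']
  · intro z hz
    filter_upwards [hx.ae_eq_variation_of_constants hw hz, hx.ae_continuous_forcing]
      with ω h hf t
    refine ⟨h t, ?_⟩
    rw [h t, ← intervalIntegral.integral_const_mul, ← intervalIntegral.integral_const_mul,
      ← intervalIntegral.integral_sub]
    · refine intervalIntegral.integral_congr fun s _ => ?_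
      simp only [LameExpansion.kernelK]
      ring
    · exact (continuous_const.mul (hw.continuous_fst.mul hf)).intervalIntegrable _ _
    · exact (continuous_const.mul (hw.continuous_snd.mul hf)).intervalIntegrable _ _
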